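/- Let $M=(P(\cdot),\varpi,r)$ be a Markov decision process with states $\{1,\dots,N\}$, actions $\{1,\dots,A\}$, transition probabilities $P(j\mid i,a)$, initial distribution $\varpi$ and deterministic rewards $r$. Let $\pi_E(a\mid s)$ be a Markov randomized policy, let $0<\varepsilon\le 1$, and suppose that actions are chosen by the exploring policy $\pi^{(E)}_a(s)=\varepsilon/A+(1-\varepsilon)\,\pi_E(a\mid s)$. Let $P_E(j\mid i)=\sum_a\pi^{(E)}_a(i)P(j\mid i,a)$ be the induced transition matrix on states, and assume that the state-action chain with transition matrix $Z((s',a')\mid(s,a))=\pi^{(E)}_{a'}(s')\,P(s'\mid s,a)$ is irreducible. Put $\theta=\max_{i,j}\bigl(\max_aP(j\mid i,a)-\min_aP(j\mid i,a)\bigr)$ and assume $\theta>0$. For a trajectory $(s_0,a_0),\dots,(s_n,a_n)$ let $m(s',s,a)$ be the number of $t\in\{1,\dots,n\}$ with $s_t=s'$ and $(s_{t-1},a_{t-1})=(s,a)$, and let $n(s,a)=\sum_{s'}m(s',s,a)$, $m'(s',s)=\sum_am(s',s,a)$, $n'(s)=\sum_{s'}m'(s',s)$. Let $$\ell_0=\frac1N\prod_{s',s}\Bigl(\frac{m'(s',s)}{n'(s)}\Bigr)^{m'(s',s)},\qquad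 \ell_1=\frac1N\prod_{(s,a):\,n(s,a)\ge1}\ \prod_{s'}\Bigl(\frac{m(s',s,a)}{n(s,a)}\Bigr)^{m(s',s,a)}$$ (factors with exponent $0$ being $1$) be the maximum likelihoods of the uncontrolled and of the controlled model, and $L_n=-2\ln(\ell_0/\ell_1)$. For a significance level $0<\alpha\le1$ let $t$ be the $(1-\alpha)$-quantile (taken to be $0$ if $\alpha=1$) of the $\chi^2$ distribution with $N(A-1)(N-1)$ degrees of freedom, and let $\beta(T)=\mathbb P(L_n\le t\text{ for all }n\le T)$ be the probability of a Type 2 error up to time $T$. Then $\beta(T)$ decays exponentially to zero: there are $\kappa>0$ and $C$ with $\beta(T)\le Ce^{-\kappa T}$ for all $T$. Moreover, the decay rate $\kappa^*=\sup\{\kappa:\lim_{T\to\infty}e^{\kappa T}\beta(T)=0\}$ satisfies $$\kappa^*\ \ge\ c\,\varepsilon^2\,\theta^2\,P_{\min}^2\,\underline{w_I}^2,\qquad c=\frac{1}{2AN(24A)^2}\,\min\Bigl\{1,\ \frac{AN\,(1-\tau_1(P_E))^2}{4}\Bigr\},$$ where $P_{\min}$ is the smallest nonzero transition probability $P(j\mid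 i,a)$, $\underline{w_I}$ is the smallest component of the Perron vector $w_I$ of $P_E$ (the probability vector with $w_IP_E=w_I$), and $\tau_1(P_E)=\frac12\max_{i,j}\sum_k|P_E(k\mid i)-P_E(k\mid j)|$. -/

import Mathlib

open Filter Topology MeasureTheory ProbabilityTheory

namespace LRTest

noncomputable section

/-- A finite Markov decision process with states `Fin N`, actions `Fin A` and deterministic
rewards: `P a i j` is the probability of moving from `i` to `j` under action `a`, and `init` is the
distribution of the initial state. -/
structure MDP (N A : ℕ) where
  P : Fin A → Matrix (Fin N) (Fin N) ℝ
  init : Fin N → ℝ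
  reward : Fin N → Fin A → ℝ
  P_mem : ∀ a, P a ∈ Matrix.rowStochastic ℝ (Fin N)
  init_mem : init ∈ stdSimplex ℝ (Fin N)

/-- A Markov randomized policy: `prob s a` is the probability of action `a` in state `s`. -/
structure Policy (N A : ℕ) where
  prob : Fin N → Fin A → ℝ
  prob_mem : ∀ s, prob s ∈ stdSimplex ℝ (Fin A)

/-- The exploring policy: with probability `ε` a uniformly random action is chosen, otherwise the
exploitation policy `π` is followed. -/
def Policy.explore {N A : ℕ} (π : Policy N A) (ε : ℝ) (hε : ε ∈ Set.Icc (0 : ℝ) 1) :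
    Policy N A where
  prob s a := ε / A + (1 - ε) * π.prob s a
  prob_mem s := by
    have h := π.prob_mem s
    refine ⟨fun a => ?_, ?_⟩
    · have h1 := h.1 a
      have h2 : 0 ≤ 1 - ε := sub_nonneg.2 hε.2
      have h3 := hε.1
      positivity
    · have hA : (A : ℝ) ≠ 0 := by
        rintro h0
        have h0' : A = 0 := by exact_mod_cast h0
        subst h0'
        simpa using h.2
      rw [Finset.sum_add_distrib, ← Finset.mul_sum, h.2]
      simp only [Finset.sum_const, Finset.card_univ, Fintype.card_fin, nsmul_eq_mul]
      field_simp
      ring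

/-! ### The combined system of MDP and policy -/

/-- The transition matrix on states induced by a policy. -/
def inducedMatrix {N A : ℕ} (M : MDP N A) (π : Policy N A) : Matrix (Fin N) (Fin N) ℝ :=
  fun i j => ∑ a, π.prob i a * M.P a i j

/-- The transition matrix of the state-action chain. -/
def jointMatrix {N A : ℕ} (M : MDP N A) (π : Policy N A) :
    Matrix (Fin N × Fin A) (Fin N × Fin A) ℝ :=
  fun x y => M.P x.2 x.1 y.1 * π.prob y.1 y.2

/-- The probability of the trajectory `(s₀, a₀), …, (s_T, a_T)`. -/
def trajProb {N A : ℕ} (M : MDP N A) (π : Policy N A) {T : ℕ}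
    (x : Fin (T + 1) → Fin N × Fin A) : ℝ :=
  M.init (x 0).1 * π.prob (x 0).1 (x 0).2 *
    ∏ t : Fin T, jointMatrix M π (x t.castSucc) (x t.succ)

/-- `w` is a Perron vector of `Q`: a probability row vector with `w Q = w`. -/
def IsPerronVector {N : ℕ} (Q : Matrix (Fin N) (Fin N) ℝ) (w : Fin N → ℝ) : Prop :=
  w ∈ stdSimplex ℝ (Fin N) ∧ Matrix.vecMul w Q = w

/-- The coefficient of ergodicity `τ₁(Q) = ½ max_{i,j} ∑ₖ |Q i k - Q j k|`. -/
def tau1 {N : ℕ} (Q : Matrix (Fin N) (Fin N) ℝ) : ℝ :=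
  1 / 2 * ⨆ i, ⨆ j, ∑ k, |Q i k - Q j k|

/-- `θ = max_{i,j} (max_a P(j | i, a) - min_a P(j | i, a))`. -/
def theta {N A : ℕ} (M : MDP N A) : ℝ :=
  ⨆ i, ⨆ j, ((⨆ a, M.P a i j) - ⨅ a, M.P a i j)

/-- The smallest nonzero transition probability. -/
def pMin {N A : ℕ} (M : MDP N A) : ℝ :=
  sInf {p : ℝ | p ≠ 0 ∧ ∃ a i j, M.P a i j = p}

/-! ### The likelihood-ratio test -/

section Counts

variable {N A n : ℕ} (x : Fin (n + 1) → Fin N × Fin A)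

/-- `m(s', s, a)`: the number of transitions from `(s, a)` to state `s'`. -/
def m (s' s : Fin N) (a : Fin A) : ℕ :=
  (Finset.univ.filter fun t : Fin n => (x t.succ).1 = s' ∧ x t.castSucc = (s, a)).card

/-- `n(s, a)` -/
def nSA (s : Fin N) (a : Fin A) : ℕ := ∑ s', m x s' s a

/-- `m'(s', s)` -/
def m' (s' s : Fin N) : ℕ := ∑ a, m x s' s a

/-- `n'(s)` -/
def nS (s : Fin N) : ℕ := ∑ s', m' x s' s

/-- The maximum likelihood of the uncontrolled model. (Factors with `n'(s) = 0` have exponent `0`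
and are equal to `1`.) -/
def ell0 : ℝ := 1 / N * ∏ s', ∏ s, ((m' x s' s : ℝ) / nS x s) ^ m' x s' s

/-- The maximum likelihood of the controlled model. -/
def ell1 : ℝ :=
  1 / N * ∏ y ∈ Finset.univ.filter (fun y : Fin N × Fin A => 1 ≤ nSA x y.1 y.2),
    ∏ s', ((m x s' y.1 y.2 : ℝ) / nSA x y.1 y.2) ^ m x s' y.1 y.2

/-- The test statistic `L = -2 ln (ℓ₀ / ℓ₁)`. -/
def lrStat : ℝ := -2 * Real.log (ell0 x / ell1 x)

end Counts

/-- The chi-squared distribution with `k` degrees of freedom, i.e. the Gamma distribution of shape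
`k / 2` and rate `1 / 2`. -/
def chiSq (k : ℕ) : Measure ℝ := gammaMeasure (k / 2) (1 / 2)

/-- The `p`-quantile of the chi-squared distribution with `k` degrees of freedom, as a point of
its support `[0, ∞)`. -/
def chiSqQuantile (k : ℕ) (p : ℝ) : ℝ := sInf {t : ℝ | 0 ≤ t ∧ p ≤ cdf (chiSq k) t}

open Classical in
/-- The probability that a test of significance level `α` accepts the uncontrolled model at all
times `n ≤ T`, i.e. `L ≤ t` up to time `T`, when trajectories are generated by `M` and `π`. -/
def typeTwoError {N A : ℕ} (M : MDP N A) (π : Policy N A) (α : ℝ) (T : ℕ) : ℝ :=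
  ∑ x ∈ Finset.univ.filter (fun x : Fin (T + 1) → Fin N × Fin A =>
      ∀ (n : ℕ) (hn : n ≤ T),
        lrStat (fun i : Fin (n + 1) => x (Fin.castLE (Nat.succ_le_succ hn) i)) ≤
          chiSqQuantile (N * (A - 1) * (N - 1)) (1 - α)),
    trajProb M π x

/-- `κ* = sup {κ : e^{κT} β(T) → 0}`, as an extended real number. -/
def decayRate (β : ℕ → ℝ) : EReal :=
  sSup ((fun κ : ℝ => (κ : EReal)) ''
    {κ : ℝ | Tendsto (fun T : ℕ => Real.exp (κ * T) * β T) atTop (𝓝 0)})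

end

end LRTest

/-! Fix `i, j, a, b` with P(j|i,a) − P(j|i,b) = θ. Acceptance at the last time T alone is already
exponentially unlikely. The statistic is 2 Σ n(s,a) KL(empirical law after (s,a) ‖ pooled empirical
law in s). Each divergence dominates a squared Hellinger distance, hence a quarter of the squared
difference of any one frequency (`le_lrStat`). If the statistic stays below a fixed t while (i,a)
and (i,b) are both visited linearly often, the two empirical frequencies of j are close to the
pooled one and so to each other. As the true probabilities are θ apart, one frequency is off by at
least θ/4 (`deviation_of_lrStat_le`).

Acceptance thus lies in a union of four events: too few visits to (i,a) or to (i,b), or a deviation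
of one of the two frequencies. Each is bounded by `azuma`. For deviations the martingale is m(j,i,a)
− n(i,a) P(j|i,a). For visits to y it comes from the Poisson equation h = 1_y − c + Zh, which
irreducibility makes solvable with c > 0 (`exists_poisson`). This already gives exponential decay.

For the explicit rate, c is the stationary probability of the pair, at least (min w) ε/A
(`poisson_const_eq`), and the oscillation of h is at most 2/(1 − τ₁) by contraction of the state
chain (`poisson_osc_le`). -/

namespace LRTest

/-! ### Exponential bounds for finite Markov chains -/

section Chain

variable {S : Type*}

/-- The weight of a path of a chain with initial weights `μ` and transition kernel `K`. -/
noncomputable def pathWeight (μ : S → ℝ) (K : S → S → ℝ) {T : ℕ} (x : Fin (T + 1) → S) : ℝ :=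
  μ (x 0) * ∏ t : Fin T, K (x t.castSucc) (x t.succ)

lemma pathWeight_nonneg {μ : S → ℝ} {K : S → S → ℝ} (hμ : ∀ s, 0 ≤ μ s)
    (hK : ∀ s s', 0 ≤ K s s') {T : ℕ} (x : Fin (T + 1) → S) : 0 ≤ pathWeight μ K x :=
  mul_nonneg (hμ _) (Finset.prod_nonneg fun _ _ => hK _ _)

variable [Fintype S]

/-- Summing out the first state replaces the initial weights μ by μK, which drives inductions on the
path length. -/
lemma sum_pathWeight_succ (μ : S → ℝ) (K : S → S → ℝ) (T : ℕ) :
    ∑ x : Fin (T + 2) → S, pathWeight μ K x =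
      ∑ x : Fin (T + 1) → S, pathWeight (fun y => ∑ s, μ s * K s y) K x := by
  rw [← (Fin.consEquiv fun _ : Fin (T + 2) => S).sum_comp, Fintype.sum_prod_type_right]
  refine Finset.sum_congr rfl fun x _ => ?_
  simp only [pathWeight, Fin.consEquiv, Equiv.coe_fn_mk, Fin.cons_zero, Finset.sum_mul]
  refine Finset.sum_congr rfl fun s _ => ?_
  rw [Fin.prod_univ_succ]
  simp [mul_assoc]

/-- The kernel need not be stochastic: the main use is an exponentially tilted kernel, with r a
bound on the conditional moment generating function. -/
lemma sum_pathWeight_le {K : S → S → ℝ} {r : ℝ} (hr : 0 ≤ r)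
    (hKr : ∀ s, ∑ s', K s s' ≤ r) (hK : ∀ s s', 0 ≤ K s s') (T : ℕ) :
    ∀ μ : S → ℝ, (∀ s, 0 ≤ μ s) →
      ∑ x : Fin (T + 1) → S, pathWeight μ K x ≤ (∑ s, μ s) * r ^ T := by
  induction T with
  | zero =>
    intro μ hμ
    rw [← (Equiv.funUnique (Fin 1) S).symm.sum_comp]
    simp [pathWeight]
  | succ T ih =>
    intro μ hμ
    rw [sum_pathWeight_succ]
    refine (ih _ fun y => Finset.sum_nonneg fun s _ => mul_nonneg (hμ s) (hK s y)).trans ?_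
    rw [pow_succ', ← mul_assoc]
    refine mul_le_mul_of_nonneg_right ?_ (pow_nonneg hr T)
    rw [Finset.sum_comm, Finset.sum_mul]
    refine Finset.sum_le_sum fun s _ => ?_
    rw [← Finset.mul_sum]
    exact mul_le_mul_of_nonneg_left (hKr s) (hμ s)

/-- By convexity, exp lies below its chord over the interval with endpoints ±lb. -/
lemma exp_mul_le_cosh_add {b l z : ℝ} (hb : 0 < b) (hz : |z| ≤ b) :
    Real.exp (l * z) ≤ Real.cosh (l * b) + z / b * Real.sinh (l * b) := by
  have h := abs_le.1 hz
  have hc := convexOn_exp.2 (Set.mem_univ (l * b)) (Set.mem_univ (-(l * b)))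
    (show 0 ≤ (b + z) / (2 * b) from div_nonneg (by linarith) (by linarith))
    (show 0 ≤ (b - z) / (2 * b) from div_nonneg (by linarith) (by linarith))
    (by field_simp; ring)
  have e : ((b + z) / (2 * b)) • (l * b) + ((b - z) / (2 * b)) • (-(l * b)) = l * z := by
    simp only [smul_eq_mul]; field_simp; ring
  rw [e] at hc
  refine hc.trans (le_of_eq ?_)
  rw [Real.cosh_eq, Real.sinh_eq]
  simp only [smul_eq_mul]
  field_simp
  ring

/-- The conditional Hoeffding lemma (with the range `[-b, b]`). -/
lemma sum_mul_exp_le {p z : S → ℝ} {b : ℝ} (hb : 0 < b) (l : ℝ) (hp : ∀ s, 0 ≤ p s)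
    (hp1 : ∑ s, p s = 1) (hz : ∀ s, |z s| ≤ b) (h0 : ∑ s, p s * z s = 0) :
    ∑ s, p s * Real.exp (l * z s) ≤ Real.exp ((l * b) ^ 2 / 2) := by
  calc ∑ s, p s * Real.exp (l * z s)
      ≤ ∑ s, p s * (Real.cosh (l * b) + z s / b * Real.sinh (l * b)) :=
        Finset.sum_le_sum fun s _ =>
          mul_le_mul_of_nonneg_left (exp_mul_le_cosh_add hb (hz s)) (hp s)
    _ = (∑ s, p s) * Real.cosh (l * b) + (∑ s, p s * z s) * (Real.sinh (l * b) / b) := by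
        rw [Finset.sum_mul, Finset.sum_mul, ← Finset.sum_add_distrib]
        exact Finset.sum_congr rfl fun s _ => by ring
    _ ≤ _ := by
        rw [hp1, h0, one_mul, zero_mul, add_zero]
        exact Real.cosh_le_exp_half_sq _

/-- The Azuma-Hoeffding inequality for additive functionals of a finite Markov chain whose
increments have conditional mean zero. -/
lemma azuma {μ : S → ℝ} {Z : S → S → ℝ} (hμ : ∀ s, 0 ≤ μ s) (hμ1 : ∑ s, μ s = 1)
    (hZ : ∀ s s', 0 ≤ Z s s') (hZ1 : ∀ s, ∑ s', Z s s' = 1) {φ : S → S → ℝ} {b u : ℝ}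
    (hb : 0 < b) (hu : 0 ≤ u) (hφ : ∀ s s', |φ s s'| ≤ b) (h0 : ∀ s, ∑ s', Z s s' * φ s s' = 0)
    {T : ℕ} (E : Finset (Fin (T + 1) → S))
    (hE : ∀ x ∈ E, T * u ≤ ∑ t : Fin T, φ (x t.castSucc) (x t.succ)) :
    ∑ x ∈ E, pathWeight μ Z x ≤ Real.exp (-(u ^ 2 / (2 * b ^ 2) * T)) := by
  -- This l minimises the Chernoff exponent (lb)²/2 − lu, with minimum −u²/(2b²).
  set l : ℝ := u / b ^ 2 with hl
  have hl0 : 0 ≤ l := by positivity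
  -- Tilting the kernel absorbs the exponential of the additive functional into the path weight.
  set K : S → S → ℝ := fun s s' => Z s s' * Real.exp (l * φ s s') with hKdef
  have hK : ∀ s s', 0 ≤ K s s' := fun s s' => mul_nonneg (hZ s s') (Real.exp_pos _).le
  have key : ∀ x : Fin (T + 1) → S, pathWeight μ K x =
      pathWeight μ Z x * Real.exp (l * ∑ t : Fin T, φ (x t.castSucc) (x t.succ)) := by
    intro x
    simp only [pathWeight, hKdef, Finset.prod_mul_distrib, Finset.mul_sum, Real.exp_sum, mul_assoc]
  have h1 := sum_pathWeight_le (Real.exp_pos ((l * b) ^ 2 / 2)).le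
    (fun s => sum_mul_exp_le hb l (hZ s) (hZ1 s) (hφ s) (h0 s)) hK T μ hμ
  rw [hμ1, one_mul] at h1
  have h2 : (∑ x ∈ E, pathWeight μ Z x) * Real.exp (l * (T * u)) ≤
      ∑ x : Fin (T + 1) → S, pathWeight μ K x := by
    rw [Finset.sum_mul]
    refine (Finset.sum_le_sum fun x hx => ?_).trans
      (Finset.sum_le_sum_of_subset_of_nonneg (Finset.subset_univ E)
        fun x _ _ => pathWeight_nonneg hμ hK x)
    rw [key]
    exact mul_le_mul_of_nonneg_left
      (Real.exp_le_exp.2 (mul_le_mul_of_nonneg_left (hE x hx) hl0)) (pathWeight_nonneg hμ hZ x)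
  have h3 := h2.trans h1
  rw [← le_div_iff₀ (Real.exp_pos _), ← Real.exp_nat_mul, ← Real.exp_sub] at h3
  refine h3.trans (le_of_eq ?_)
  congr 1
  rw [hl]
  field_simp
  ring

/-! ### The Poisson equation -/

variable [DecidableEq S]

/-- A superharmonic function of an irreducible chain is constant. -/
lemma eq_of_superharmonic {Z : Matrix S S ℝ} (hZ : Z ∈ Matrix.rowStochastic ℝ S)
    (hirr : Z.IsIrreducible) {h : S → ℝ} (hh : ∀ s, (Z.mulVec h) s ≤ h s) (s s' : S) :
    h s = h s' := by
  have : Nonempty S := ⟨s⟩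
  obtain ⟨y, hy⟩ := Finite.exists_min h
  have hpow : ∀ k : ℕ, ∀ s, ((Z ^ k).mulVec h) s ≤ h s := by
    intro k
    induction k with
    | zero => intro s; simp
    | succ k ih =>
      intro s
      rw [pow_succ', ← Matrix.mulVec_mulVec]
      refine le_trans ?_ (hh s)
      exact Finset.sum_le_sum fun z _ => mul_le_mul_of_nonneg_left (ih z) (hZ.1 s z)
  have hmin : ∀ z, h z = h y := by
    intro z
    obtain ⟨k, -, hk⟩ := (Matrix.isIrreducible_iff_exists_pow_pos hZ.1).1 hirr y z
    have hZk := pow_mem hZ k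
    have h1 := hpow k y
    -- At a minimum y of h, the nonnegative function h − h y has nonpositive mean under row y of
    -- Z^k. It therefore vanishes at every z that this row charges.
    have h2 : ∑ w, (Z ^ k) y w * (h w - h y) ≤ 0 := by
      simp only [mul_sub, Finset.sum_sub_distrib, ← Finset.sum_mul,
        Matrix.sum_row_of_mem_rowStochastic hZk y, one_mul]
      simpa [Matrix.mulVec, dotProduct] using h1
    have h3 : (Z ^ k) y z * (h z - h y) ≤ 0 :=
      (Finset.single_le_sum (f := fun w => (Z ^ k) y w * (h w - h y))
        (fun w _ => mul_nonneg (hZk.1 y w) (sub_nonneg.2 (hy w))) (Finset.mem_univ z)).trans h2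
    exact le_antisymm (by nlinarith) (hy z)
  rw [hmin s, hmin s']

/-- Finite-dimensional Fredholm argument: normalise h y = 0 and use the freed coordinate y to store
the unknown c. The map (h, c) ↦ h − Zh + c is then an endomorphism, so injectivity gives
surjectivity. -/
lemma exists_poisson {Z : Matrix S S ℝ} (hZ : Z ∈ Matrix.rowStochastic ℝ S)
    (hirr : Z.IsIrreducible) (y : S) :
    ∃ (h : S → ℝ) (c : ℝ), 0 < c ∧ ∀ s, h s = (if s = y then 1 else 0) - c + (Z.mulVec h) s := by
  have hne : Nonempty S := ⟨y⟩
  -- Maximum principle: evaluate at a maximum of h. Applied to h and to −h, it forces the constant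
  -- of a homogeneous solution to be 0.
  have hconst : ∀ (h : S → ℝ) (c : ℝ), (∀ s, h s ≤ - c + (Z.mulVec h) s) → c ≤ 0 := by
    intro h c hc
    obtain ⟨s, hs⟩ := Finite.exists_max h
    have h1 : (Z.mulVec h) s ≤ h s := by
      calc ∑ z, Z s z * h z ≤ ∑ z, Z s z * h s :=
            Finset.sum_le_sum fun z _ => mul_le_mul_of_nonneg_left (hs z) (hZ.1 s z)
        _ = h s := by
          rw [← Finset.sum_mul, Matrix.sum_row_of_mem_rowStochastic hZ s, one_mul]
    linarith [hc s]
  -- on functions vanishing at `y`, the operator `(h, c) ↦ h - Z h + c` is injective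
  let D : (S → ℝ) →ₗ[ℝ] (S → ℝ) :=
    { toFun := fun g s => Function.update g y 0 s - (Z.mulVec (Function.update g y 0)) s + g y
      map_add' := by
        intro f g
        have : Function.update (f + g) y 0 = Function.update f y 0 + Function.update g y 0 := by
          rw [← Function.update_add]; simp
        ext s
        rw [this, Matrix.mulVec_add]
        simp only [Pi.add_apply]
        ring
      map_smul' := by
        intro a g
        have : Function.update (a • g) y 0 = a • Function.update g y 0 := by
          rw [← Function.update_smul]; simp
        ext s
        rw [this, Matrix.mulVec_smul]
        simp only [Pi.smul_apply, smul_eq_mul, RingHom.id_apply]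
        ring }
  have hD : ∀ g s, D g s =
      Function.update g y 0 s - (Z.mulVec (Function.update g y 0)) s + g y := fun _ _ => rfl
  have hinj : Function.Injective D := by
    rw [injective_iff_map_eq_zero]
    intro g hg
    have h1 : ∀ s, Function.update g y 0 s = - g y + (Z.mulVec (Function.update g y 0)) s := by
      intro s
      have := congrFun hg s
      rw [hD, Pi.zero_apply] at this
      linarith
    have h2 := hconst _ _ fun s => (h1 s).le
    have h3 := hconst (-Function.update g y 0) (-g y) fun s => by
      rw [Matrix.mulVec_neg, Pi.neg_apply, Pi.neg_apply, h1 s]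
      linarith
    have h4 : g y = 0 := by linarith
    ext s
    have h5 := eq_of_superharmonic hZ hirr (h := Function.update g y 0)
      (fun s => by rw [h1 s, h4]; simp) s y
    rcases eq_or_ne s y with rfl | hs
    · simpa using h4
    · simpa [hs] using h5
  obtain ⟨g, hg⟩ := LinearMap.injective_iff_surjective.1 hinj (fun s => if s = y then 1 else 0)
  refine ⟨Function.update g y 0, g y, ?_, fun s => ?_⟩
  · have hs : ∀ s, Function.update g y 0 s =
        (if s = y then 1 else 0) - g y + (Z.mulVec (Function.update g y 0)) s := by
      intro s
      have := congrFun hg s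
      rw [hD] at this
      linarith
    -- If c ≤ 0 then h is superharmonic, hence constant, and the equation at y reads 1 − c = 0.
    by_contra hc
    have hsup : ∀ s, (Z.mulVec (Function.update g y 0)) s ≤ Function.update g y 0 s := by
      intro s
      rw [hs s]
      split_ifs <;> linarith
    have hcst := eq_of_superharmonic hZ hirr hsup
    have h1 : (Z.mulVec (Function.update g y 0)) y = Function.update g y 0 y := by
      calc ∑ z, Z y z * Function.update g y 0 z = ∑ z, Z y z * Function.update g y 0 y :=
            Finset.sum_congr rfl fun z _ => by rw [hcst z y]
        _ = _ := by rw [← Finset.sum_mul, Matrix.sum_row_of_mem_rowStochastic hZ y, one_mul]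
    have h2 := hs y
    rw [h1] at h2
    simp at h2
    linarith
  · have := congrFun hg s
    rw [hD] at this
    linarith

/-- Visits to a state are unlikely to be much rarer than the constant of the Poisson equation. -/
lemma eventually_sum_pathWeight_rare_le {μ : S → ℝ} {Z : Matrix S S ℝ} (hμ : ∀ s, 0 ≤ μ s)
    (hμ1 : ∑ s, μ s = 1) (hZ : Z ∈ Matrix.rowStochastic ℝ S) {y : S} {h : S → ℝ} {c B : ℝ}
    (hc : 0 < c) (hB : 0 < B) (hh : ∀ s, h s ≤ (if s = y then 1 else 0) - c + (Z.mulVec h) s)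
    (hosc : ∀ s s', h s - h s' ≤ B) :
    ∀ᶠ T : ℕ in atTop, ∀ E : Finset (Fin (T + 1) → S),
      (∀ x ∈ E, ((Finset.univ.filter fun t : Fin T => x t.castSucc = y).card : ℝ) ≤ c / 2 * T) →
      ∑ x ∈ E, pathWeight μ Z x ≤ Real.exp (-((c / 4) ^ 2 / (2 * B ^ 2) * T)) := by
  -- Of the surplus cT/2 left by rare visits, a part cT/4 pays for the boundary term B of the
  -- telescoping sum.
  have hlim : ∀ᶠ T : ℕ in atTop, B / (c / 4) ≤ (T : ℝ) :=
    tendsto_natCast_atTop_atTop.eventually_ge_atTop _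
  filter_upwards [hlim] with T hT E hE
  rw [div_le_iff₀ (by positivity)] at hT
  have hrow := Matrix.sum_row_of_mem_rowStochastic hZ
  have hdiff : ∀ s s', (Z.mulVec h) s - h s' = ∑ z, Z s z * (h z - h s') := by
    intro s s'
    simp only [mul_sub, Finset.sum_sub_distrib, ← Finset.sum_mul, hrow s, one_mul]
    rfl
  refine azuma hμ hμ1 hZ.1 hrow (φ := fun s s' => (Z.mulVec h) s - h s') hB (by positivity)
    (fun s s' => ?_) (fun s => ?_) E fun x hx => ?_
  · rw [abs_le, hdiff]
    constructor
    · calc -B = ∑ z, Z s z * (-B) := by rw [← Finset.sum_mul, hrow s, one_mul]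
        _ ≤ _ := Finset.sum_le_sum fun z _ =>
          mul_le_mul_of_nonneg_left (by linarith [hosc s' z]) (hZ.1 s z)
    · calc ∑ z, Z s z * (h z - h s') ≤ ∑ z, Z s z * B := Finset.sum_le_sum fun z _ =>
          mul_le_mul_of_nonneg_left (hosc z s') (hZ.1 s z)
        _ = B := by rw [← Finset.sum_mul, hrow s, one_mul]
  · simp only [mul_sub, Finset.sum_sub_distrib, ← Finset.sum_mul, hrow s, one_mul]
    exact sub_self _
  -- By the Poisson inequality, the martingale sum is at least h(x₀) − h(x_T) + cT minus the number
  -- of visits to y.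
  · have h1 : ∀ t : Fin T, (h (x t.castSucc) - h (x t.succ)) + c -
        (if x t.castSucc = y then 1 else 0) ≤ (Z.mulVec h) (x t.castSucc) - h (x t.succ) := by
      intro t
      linarith [hh (x t.castSucc)]
    have h2 : ∑ t : Fin T, (h (x t.castSucc) - h (x t.succ)) = h (x 0) - h (x (Fin.last T)) := by
      rw [Finset.sum_sub_distrib]
      have e1 := Fin.sum_univ_succ fun i => h (x i)
      have e2 := Fin.sum_univ_castSucc fun i => h (x i)
      linarith
    have h3 : ∑ t : Fin T, (if x t.castSucc = y then (1 : ℝ) else 0) =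
        (Finset.univ.filter fun t : Fin T => x t.castSucc = y).card := by
      simp
    refine le_trans ?_ (Finset.sum_le_sum fun t _ => h1 t)
    rw [Finset.sum_sub_distrib, Finset.sum_add_distrib, h2, h3]
    simp only [Finset.sum_const, Finset.card_univ, Fintype.card_fin, nsmul_eq_mul]
    linarith [hosc (x (Fin.last T)) (x 0), hE x hx]

end Chain

/-! ### A quadratic lower bound for the test statistic -/

/-- Termwise form of KL ≥ squared Hellinger distance, from log √(q/p) ≤ √(q/p) − 1. The terms p − q
cancel when summed over two probability vectors. -/
lemma sq_sqrt_sub_add_le_mul_log {p q : ℝ} (hp : 0 ≤ p) (hq : 0 ≤ q) (hpq : p ≠ 0 → q ≠ 0) :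
    (√p - √q) ^ 2 + p - q ≤ p * (Real.log p - Real.log q) := by
  rcases hp.eq_or_lt with rfl | hp
  · simp [Real.sq_sqrt hq]
  · have hq : 0 < q := hq.lt_of_ne' (hpq hp.ne')
    have h1 := Real.log_le_sub_one_of_pos (div_pos (Real.sqrt_pos.2 hq) (Real.sqrt_pos.2 hp))
    rw [Real.log_div (Real.sqrt_pos.2 hq).ne' (Real.sqrt_pos.2 hp).ne',
      Real.log_sqrt hq.le, Real.log_sqrt hp.le] at h1
    have h2 := mul_le_mul_of_nonneg_left h1 hp.le
    have h3 : p * (√q / √p - 1) = √p * √q - p := by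
      nth_rewrite 1 [← Real.mul_self_sqrt hp.le]
      field_simp
      rw [mul_sub, Real.mul_self_sqrt hp.le]
    rw [h3] at h2
    nlinarith [Real.sq_sqrt hp.le, Real.sq_sqrt hq.le]

lemma sq_sub_le_four_mul_sq_sqrt_sub {p q : ℝ} (hp : p ∈ Set.Icc (0 : ℝ) 1)
    (hq : q ∈ Set.Icc (0 : ℝ) 1) : (p - q) ^ 2 ≤ 4 * (√p - √q) ^ 2 := by
  have h1 : p - q = (√p - √q) * (√p + √q) := by
    nlinarith [Real.sq_sqrt hp.1, Real.sq_sqrt hq.1]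
  have h2 : √p ≤ 1 := Real.sqrt_le_one.2 hp.2
  have h3 : √q ≤ 1 := Real.sqrt_le_one.2 hq.2
  have h4 : (√p + √q) ^ 2 ≤ 4 := by nlinarith [Real.sqrt_nonneg p, Real.sqrt_nonneg q]
  rw [h1, mul_pow, mul_comm]
  exact mul_le_mul_of_nonneg_right h4 (sq_nonneg _)

section Counts

variable {N A n : ℕ} (x : Fin (n + 1) → Fin N × Fin A)

lemma m_le_m' (s' s : Fin N) (a : Fin A) : m x s' s a ≤ m' x s' s :=
  Finset.single_le_sum (f := fun a => m x s' s a) (fun _ _ => Nat.zero_le _) (Finset.mem_univ a)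

lemma m_le_nSA (s' s : Fin N) (a : Fin A) : m x s' s a ≤ nSA x s a :=
  Finset.single_le_sum (f := fun s' => m x s' s a) (fun _ _ => Nat.zero_le _) (Finset.mem_univ s')

lemma m'_le_nS (s' s : Fin N) : m' x s' s ≤ nS x s :=
  Finset.single_le_sum (f := fun s' => m' x s' s) (fun _ _ => Nat.zero_le _) (Finset.mem_univ s')

lemma nSA_le_nS (s : Fin N) (a : Fin A) : nSA x s a ≤ nS x s :=
  Finset.sum_le_sum fun s' _ => m_le_m' x s' s a

lemma nSA_eq_card (s : Fin N) (a : Fin A) :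
    nSA x s a = (Finset.univ.filter fun t : Fin n => x t.castSucc = (s, a)).card := by
  rw [nSA, Finset.card_eq_sum_card_fiberwise (f := fun t => (x t.succ).1) (t := Finset.univ)
    fun _ _ => Finset.mem_coe.2 (Finset.mem_univ _)]
  refine Finset.sum_congr rfl fun s' _ => ?_
  rw [m, Finset.filter_filter]
  congr 1
  ext t
  simp [and_comm]

/-- The convention 0⁰ = 1 covers k = 0, even with l = 0, so logarithms of the likelihoods split
factor by factor. -/
lemma natCast_pow_div_pos {k l : ℕ} (h : k ≤ l) : 0 < ((k : ℝ) / l) ^ k := by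
  rcases Nat.eq_zero_or_pos k with rfl | hk
  · simp
  · exact pow_pos (div_pos (Nat.cast_pos.2 hk) (Nat.cast_pos.2 (hk.trans_le h))) _

/-- Splitting m' over the actions gives the same weights m as in `log_ell1`, so the two
log-likelihoods can be compared term by term. -/
lemma log_ell0 (hN : N ≠ 0) : Real.log (ell0 x) = Real.log (1 / N) +
    ∑ s, ∑ a, ∑ s', m x s' s a * Real.log ((m' x s' s : ℝ) / nS x s) := by
  have hpos := fun s' s => natCast_pow_div_pos (m'_le_nS x s' s)
  have hN' : (1 / N : ℝ) ≠ 0 := one_div_ne_zero (Nat.cast_ne_zero.2 hN)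
  rw [ell0, Real.log_mul hN' (Finset.prod_pos fun s' _ => Finset.prod_pos fun s _ => hpos s' s).ne',
    Real.log_prod fun s' _ => (Finset.prod_pos fun s _ => hpos s' s).ne']
  simp only [Real.log_prod fun s _ => (hpos _ s).ne', Real.log_pow]
  rw [Finset.sum_comm]
  congr 1
  refine Finset.sum_congr rfl fun s _ => ?_
  rw [Finset.sum_comm]
  refine Finset.sum_congr rfl fun s' _ => ?_
  rw [← Finset.sum_mul, m', Nat.cast_sum]

lemma log_ell1 (hN : N ≠ 0) : Real.log (ell1 x) = Real.log (1 / N) +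
    ∑ s, ∑ a, ∑ s', m x s' s a * Real.log ((m x s' s a : ℝ) / nSA x s a) := by
  have hpos := fun s' s a => natCast_pow_div_pos (m_le_nSA x s' s a)
  have hN' : (1 / N : ℝ) ≠ 0 := one_div_ne_zero (Nat.cast_ne_zero.2 hN)
  have huniv : ∏ y ∈ Finset.univ.filter (fun y : Fin N × Fin A => 1 ≤ nSA x y.1 y.2),
      ∏ s', ((m x s' y.1 y.2 : ℝ) / nSA x y.1 y.2) ^ m x s' y.1 y.2 =
      ∏ s, ∏ a, ∏ s', ((m x s' s a : ℝ) / nSA x s a) ^ m x s' s a := by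
    rw [← Fintype.prod_prod_type' (f := fun s a =>
      ∏ s', ((m x s' s a : ℝ) / nSA x s a) ^ m x s' s a)]
    refine Finset.prod_subset (Finset.filter_subset _ _) fun y _ hy => ?_
    refine Finset.prod_eq_one fun s' _ => ?_
    have h0 : m x s' y.1 y.2 = 0 := by
      have := m_le_nSA x s' y.1 y.2
      simp only [Finset.mem_filter, Finset.mem_univ, true_and] at hy
      omega
    rw [h0, pow_zero]
  rw [ell1, huniv, Real.log_mul hN' (Finset.prod_pos fun s _ => Finset.prod_pos fun a _ =>
      Finset.prod_pos fun s' _ => hpos s' s a).ne',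
    Real.log_prod fun s _ => (Finset.prod_pos fun a _ =>
      Finset.prod_pos fun s' _ => hpos s' s a).ne']
  congr 1
  refine Finset.sum_congr rfl fun s _ => ?_
  rw [Real.log_prod fun a _ => (Finset.prod_pos fun s' _ => hpos s' s a).ne']
  refine Finset.sum_congr rfl fun a _ => ?_
  rw [Real.log_prod fun s' _ => (hpos s' s a).ne']
  simp only [Real.log_pow]

lemma ell0_pos (hN : N ≠ 0) : 0 < ell0 x :=
  mul_pos (one_div_pos.2 (Nat.cast_pos.2 (Nat.pos_of_ne_zero hN)))
    (Finset.prod_pos fun s' _ => Finset.prod_pos fun s _ => natCast_pow_div_pos (m'_le_nS x s' s))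

lemma ell1_pos (hN : N ≠ 0) : 0 < ell1 x :=
  mul_pos (one_div_pos.2 (Nat.cast_pos.2 (Nat.pos_of_ne_zero hN)))
    (Finset.prod_pos fun y _ => Finset.prod_pos fun s' _ =>
      natCast_pow_div_pos (m_le_nSA x s' y.1 y.2))

lemma sum_div_nSA {s : Fin N} {a : Fin A} (h : nSA x s a ≠ 0) :
    ∑ s', (m x s' s a : ℝ) / nSA x s a = 1 := by
  rw [← Finset.sum_div, ← Nat.cast_sum]
  exact div_self (Nat.cast_ne_zero.2 h)

lemma sum_div_nS {s : Fin N} (h : nS x s ≠ 0) : ∑ s', (m' x s' s : ℝ) / nS x s = 1 := by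
  rw [← Finset.sum_div, ← Nat.cast_sum]
  exact div_self (Nat.cast_ne_zero.2 h)

lemma le_sum_mul_log (s : Fin N) (a : Fin A) (j : Fin N) :
    nSA x s a * ((m x j s a : ℝ) / nSA x s a - (m' x j s : ℝ) / nS x s) ^ 2 / 4 ≤
      ∑ s', m x s' s a * (Real.log ((m x s' s a : ℝ) / nSA x s a) -
        Real.log ((m' x s' s : ℝ) / nS x s)) := by
  rcases eq_or_ne (nSA x s a) 0 with h0 | h0
  · have h1 : ∀ s', m x s' s a = 0 := fun s' => Nat.le_zero.1 (h0 ▸ m_le_nSA x s' s a)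
    simp [h0, h1]
  have hS : nS x s ≠ 0 := fun h => h0 (Nat.le_zero.1 (h ▸ nSA_le_nS x s a))
  have hn : (0 : ℝ) < nSA x s a := Nat.cast_pos.2 (Nat.pos_of_ne_zero h0)
  set p : Fin N → ℝ := fun s' => (m x s' s a : ℝ) / nSA x s a with hp
  set q : Fin N → ℝ := fun s' => (m' x s' s : ℝ) / nS x s with hq
  have hp01 : ∀ s', p s' ∈ Set.Icc (0 : ℝ) 1 := fun s' =>
    ⟨by positivity, div_le_one_of_le₀ (Nat.cast_le.2 (m_le_nSA x s' s a)) (by positivity)⟩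
  have hq01 : ∀ s', q s' ∈ Set.Icc (0 : ℝ) 1 := fun s' =>
    ⟨by positivity, div_le_one_of_le₀ (Nat.cast_le.2 (m'_le_nS x s' s)) (by positivity)⟩
  have hm : ∀ s', (m x s' s a : ℝ) = nSA x s a * p s' := fun s' => by
    simp only [hp]; field_simp
  -- Absolute continuity of the empirical law with respect to the pooled one, since m ≤ m'.
  have hpq : ∀ s', p s' ≠ 0 → q s' ≠ 0 := fun s' h => by
    have h1 : m x s' s a ≠ 0 := fun h1 => h (by simp [hp, h1])
    have h2 : m' x s' s ≠ 0 := fun h2 => h1 (Nat.le_zero.1 (h2 ▸ m_le_m' x s' s a))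
    exact div_ne_zero (Nat.cast_ne_zero.2 h2) (Nat.cast_ne_zero.2 hS)
  have hsum : (p j - q j) ^ 2 / 4 ≤ ∑ s', p s' * (Real.log (p s') - Real.log (q s')) := by
    calc (p j - q j) ^ 2 / 4 ≤ (√(p j) - √(q j)) ^ 2 := by
          linarith [sq_sub_le_four_mul_sq_sqrt_sub (hp01 j) (hq01 j)]
      _ ≤ ∑ s', (√(p s') - √(q s')) ^ 2 :=
          Finset.single_le_sum (f := fun s' => (√(p s') - √(q s')) ^ 2)
            (fun _ _ => sq_nonneg _) (Finset.mem_univ j)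
      _ = ∑ s', ((√(p s') - √(q s')) ^ 2 + p s' - q s') := by
          rw [Finset.sum_sub_distrib, Finset.sum_add_distrib, sum_div_nSA x h0, sum_div_nS x hS]
          ring
      _ ≤ _ := Finset.sum_le_sum fun s' _ =>
          sq_sqrt_sub_add_le_mul_log (hp01 s').1 (hq01 s').1 (hpq s')
  calc (nSA x s a : ℝ) * (p j - q j) ^ 2 / 4 = nSA x s a * ((p j - q j) ^ 2 / 4) := by ring
    _ ≤ nSA x s a * ∑ s', p s' * (Real.log (p s') - Real.log (q s')) :=
        mul_le_mul_of_nonneg_left hsum hn.le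
    _ = _ := by
        rw [Finset.mul_sum]
        refine Finset.sum_congr rfl fun s' _ => ?_
        change _ = (m x s' s a : ℝ) * (Real.log (p s') - Real.log (q s'))
        rw [hm s', mul_assoc]

/-- If the empirical transition frequencies under an action differ from those of the uncontrolled
model, then the test statistic is large. -/
lemma le_lrStat (hN : N ≠ 0) (s : Fin N) (a : Fin A) (j : Fin N) :
    nSA x s a * ((m x j s a : ℝ) / nSA x s a - (m' x j s : ℝ) / nS x s) ^ 2 / 2 ≤ lrStat x := by
  set F : Fin N → Fin A → ℝ := fun s a => ∑ s', m x s' s a *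
    (Real.log ((m x s' s a : ℝ) / nSA x s a) - Real.log ((m' x s' s : ℝ) / nS x s)) with hF
  have hF0 : ∀ s a, 0 ≤ F s a := fun s a => le_trans (by positivity) (le_sum_mul_log x s a j)
  have hL : lrStat x = 2 * ∑ s, ∑ a, F s a := by
    rw [lrStat, Real.log_div (ell0_pos x hN).ne' (ell1_pos x hN).ne', log_ell0 x hN, log_ell1 x hN]
    simp only [hF, mul_sub, Finset.sum_sub_distrib]
    ring
  have h1 : F s a ≤ ∑ s, ∑ a, F s a :=
    (Finset.single_le_sum (fun a _ => hF0 s a) (Finset.mem_univ a)).trans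
      (Finset.single_le_sum (f := fun s => ∑ a, F s a)
        (fun s _ => Finset.sum_nonneg fun a _ => hF0 s a) (Finset.mem_univ s))
  linarith [le_sum_mul_log x s a j]

/-- If the statistic is bounded and two actions with different transition probabilities were both
used often in a state, then the empirical frequencies deviate from the true probabilities. -/
lemma deviation_of_lrStat_le (hN : N ≠ 0) {i j : Fin N} {a b : Fin A} {t d θ P Q : ℝ}
    (hθ : 0 < θ) (hPQ : P - Q = θ) (hd : 0 < d) (hdt : 128 * t < d * θ ^ 2) (hL : lrStat x ≤ t)
    (ha : d ≤ nSA x i a) (hb : d ≤ nSA x i b) :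
    m x j i a - nSA x i a * P ≤ -(d * (θ / 4)) ∨ d * (θ / 4) ≤ m x j i b - nSA x i b * Q := by
  have hdev : ∀ a, d ≤ nSA x i a →
      |(m x j i a : ℝ) / nSA x i a - (m' x j i : ℝ) / nS x i| < θ / 8 := by
    intro a ha
    -- With r the difference of frequencies, d r²/2 ≤ t < d θ²/128 gives r² < (θ/8)²; this is the
    -- source of 128.
    refine abs_lt_of_sq_lt_sq ?_ (by positivity)
    have h1 := (le_lrStat x hN i a j).trans hL
    set r := (m x j i a : ℝ) / nSA x i a - (m' x j i : ℝ) / nS x i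
    have h2 : d * r ^ 2 ≤ nSA x i a * r ^ 2 := mul_le_mul_of_nonneg_right ha (sq_nonneg _)
    refine lt_of_mul_lt_mul_left ?_ hd.le
    nlinarith
  have hna : (0 : ℝ) < nSA x i a := hd.trans_le ha
  have hnb : (0 : ℝ) < nSA x i b := hd.trans_le hb
  have h1 := abs_lt.1 (hdev a ha)
  have h2 := abs_lt.1 (hdev b hb)
  have hma : (m x j i a : ℝ) = nSA x i a * ((m x j i a : ℝ) / nSA x i a) := by field_simp
  have hmb : (m x j i b : ℝ) = nSA x i b * ((m x j i b : ℝ) / nSA x i b) := by field_simp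
  -- The two frequencies differ by less than θ/4, so if the one for a exceeds P − θ/4, the one for b
  -- exceeds P − θ/2 = Q + θ/2.
  rcases le_total ((m x j i a : ℝ) / nSA x i a) (P - θ / 4) with h | h
  · left
    rw [hma]
    nlinarith
  · right
    rw [hmb]
    have h3 : Q + θ / 4 ≤ (m x j i b : ℝ) / nSA x i b := by linarith
    nlinarith

end Counts

/-! ### The state-action chain -/

section MDP

variable {N A : ℕ} (M : MDP N A) (π : Policy N A)

lemma jointMatrix_mem : jointMatrix M π ∈ Matrix.rowStochastic ℝ (Fin N × Fin A) := by
  rw [Matrix.mem_rowStochastic_iff_sum]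
  refine ⟨fun x y => mul_nonneg ((M.P_mem _).1 _ _) ((π.prob_mem _).1 _), fun x => ?_⟩
  simp only [jointMatrix, Fintype.sum_prod_type, ← Finset.mul_sum, (π.prob_mem _).2, mul_one]
  exact Matrix.sum_row_of_mem_rowStochastic (M.P_mem _) _

lemma inducedMatrix_mem : inducedMatrix M π ∈ Matrix.rowStochastic ℝ (Fin N) := by
  rw [Matrix.mem_rowStochastic_iff_sum]
  refine ⟨fun i j => Finset.sum_nonneg fun a _ =>
    mul_nonneg ((π.prob_mem _).1 _) ((M.P_mem _).1 _ _), fun i => ?_⟩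
  simp only [inducedMatrix]
  rw [Finset.sum_comm]
  simp only [← Finset.mul_sum, Matrix.sum_row_of_mem_rowStochastic (M.P_mem _) _, mul_one]
  exact (π.prob_mem i).2

/-- The distribution of the initial state-action pair. -/
noncomputable def initJoint (y : Fin N × Fin A) : ℝ := M.init y.1 * π.prob y.1 y.2

lemma initJoint_nonneg (y : Fin N × Fin A) : 0 ≤ initJoint M π y :=
  mul_nonneg (M.init_mem.1 _) ((π.prob_mem _).1 _)

lemma sum_initJoint : ∑ y, initJoint M π y = 1 := by
  simp only [initJoint, Fintype.sum_prod_type, ← Finset.mul_sum, (π.prob_mem _).2, mul_one]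
  exact M.init_mem.2

lemma trajProb_eq {T : ℕ} (x : Fin (T + 1) → Fin N × Fin A) :
    trajProb M π x = pathWeight (initJoint M π) (jointMatrix M π) x := rfl

lemma trajProb_nonneg {T : ℕ} (x : Fin (T + 1) → Fin N × Fin A) : 0 ≤ trajProb M π x :=
  pathWeight_nonneg (initJoint_nonneg M π) (jointMatrix_mem M π).1 x

lemma typeTwoError_nonneg (α : ℝ) (T : ℕ) : 0 ≤ typeTwoError M π α T :=
  Finset.sum_nonneg fun x _ => trajProb_nonneg M π x

lemma typeTwoError_le_one (α : ℝ) (T : ℕ) : typeTwoError M π α T ≤ 1 := by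
  have h := sum_pathWeight_le zero_le_one
    (fun s => (Matrix.sum_row_of_mem_rowStochastic (jointMatrix_mem M π) s).le)
    (jointMatrix_mem M π).1 T _ (initJoint_nonneg M π)
  rw [sum_initJoint, one_pow, one_mul] at h
  exact (Finset.sum_le_sum_of_subset_of_nonneg (Finset.subset_univ _)
    fun x _ _ => trajProb_nonneg M π x).trans h

/-- The empirical transition frequencies concentrate around the transition probabilities. -/
lemma sum_trajProb_deviation_le (i j : Fin N) (a : Fin A) {σ u : ℝ} (hσ : |σ| = 1) (hu : 0 ≤ u)
    {T : ℕ} (E : Finset (Fin (T + 1) → Fin N × Fin A))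
    (hE : ∀ x ∈ E, T * u ≤ σ * (m x j i a - nSA x i a * M.P a i j)) :
    ∑ x ∈ E, trajProb M π x ≤ Real.exp (-(u ^ 2 / 2 * T)) := by
  have hZ := jointMatrix_mem M π
  have h := azuma (initJoint_nonneg M π) (sum_initJoint M π) hZ.1
    (Matrix.sum_row_of_mem_rowStochastic hZ) (b := 1) (u := u)
    (φ := fun x y => σ * (if x = (i, a) then (if y.1 = j then 1 else 0) - M.P a i j else 0))
    one_pos hu (fun x y => ?_) (fun x => ?_) E fun x hx => ?_
  · simpa [trajProb_eq] using h
  · rw [abs_mul, hσ, one_mul]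
    have h0 := (M.P_mem a).1 i j
    have h1 := Matrix.le_one_of_mem_rowStochastic (M.P_mem a) (i := i) (j := j)
    rw [abs_le]
    split_ifs <;> constructor <;> linarith
  · by_cases hx : x = (i, a)
    · subst hx
      have h1 : ∑ y : Fin N × Fin A, jointMatrix M π (i, a) y * (if y.1 = j then 1 else 0) =
          M.P a i j := by
        simp [Fintype.sum_prod_type, jointMatrix, ← Finset.mul_sum, (π.prob_mem j).2]
      have h2 := Matrix.sum_row_of_mem_rowStochastic hZ (i, a)
      simp only [if_true]
      calc ∑ y, jointMatrix M π (i, a) y * (σ * ((if y.1 = j then 1 else 0) - M.P a i j))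
          = σ * (∑ y, jointMatrix M π (i, a) y * (if y.1 = j then 1 else 0) -
              (∑ y, jointMatrix M π (i, a) y) * M.P a i j) := by
            rw [Finset.sum_mul, ← Finset.sum_sub_distrib, Finset.mul_sum]
            exact Finset.sum_congr rfl fun y _ => by ring
        _ = 0 := by rw [h1, h2]; ring
    · simp [hx]
  · refine (hE x hx).trans (le_of_eq ?_)
    rw [← Finset.mul_sum, nSA_eq_card, m, Finset.natCast_card_filter, Finset.natCast_card_filter,
      Finset.sum_mul, ← Finset.sum_sub_distrib]
    congr 1
    refine Finset.sum_congr rfl fun t _ => ?_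
    by_cases h1 : x t.castSucc = (i, a) <;> simp [h1]

/-- An upper bound for the Type 2 error in terms of (approximate) solutions of Poisson equations. -/
lemma eventually_typeTwoError_le (α : ℝ) {i j : Fin N} {a b : Fin A} {h g : Fin N × Fin A → ℝ}
    {c B θ κ : ℝ} (hc : 0 < c) (hB : 0 < B) (hθ : 0 < θ) (hPθ : M.P a i j - M.P b i j = θ)
    (hh : ∀ s, h s ≤ (if s = (i, a) then 1 else 0) - c + ((jointMatrix M π).mulVec h) s)
    (hg : ∀ s, g s ≤ (if s = (i, b) then 1 else 0) - c + ((jointMatrix M π).mulVec g) s)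
    (hhB : ∀ s s', h s - h s' ≤ B) (hgB : ∀ s s', g s - g s' ≤ B)
    (hκ1 : κ ≤ (c / 4) ^ 2 / (2 * B ^ 2)) (hκ2 : κ ≤ (c / 2 * (θ / 4)) ^ 2 / 2) :
    ∀ᶠ T : ℕ in atTop, typeTwoError M π α T ≤ 4 * Real.exp (-(κ * T)) := by
  classical
  have hN : N ≠ 0 := i.pos.ne'
  set t := chiSqQuantile (N * (A - 1) * (N - 1)) (1 - α) with ht
  have hmono : ∀ (T : ℕ) (κ' : ℝ), κ ≤ κ' → Real.exp (-(κ' * T)) ≤ Real.exp (-(κ * T)) :=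
    fun T κ' hκ' => Real.exp_le_exp.2
      (neg_le_neg (mul_le_mul_of_nonneg_right hκ' (Nat.cast_nonneg T)))
  have hlim : ∀ᶠ T : ℕ in atTop, 128 * t / (c / 2 * θ ^ 2) < (T : ℝ) :=
    tendsto_natCast_atTop_atTop.eventually_gt_atTop _
  have hpoisson := fun {y f} => eventually_sum_pathWeight_rare_le (initJoint_nonneg M π)
    (sum_initJoint M π) (jointMatrix_mem M π) (y := y) (h := f) hc hB
  filter_upwards [hlim, eventually_gt_atTop 0, hpoisson hh hhB, hpoisson hg hgB]
    with T hT hT0 hEa hEb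
  have hT0' : (0 : ℝ) < T := Nat.cast_pos.2 hT0
  rw [div_lt_iff₀ (by positivity)] at hT
  set Ea : Finset (Fin (T + 1) → Fin N × Fin A) :=
    Finset.univ.filter fun x => (nSA x i a : ℝ) ≤ c / 2 * T
  set Eb : Finset (Fin (T + 1) → Fin N × Fin A) :=
    Finset.univ.filter fun x => (nSA x i b : ℝ) ≤ c / 2 * T
  set Da : Finset (Fin (T + 1) → Fin N × Fin A) := Finset.univ.filter fun x =>
    T * (c / 2 * (θ / 4)) ≤ -1 * (m x j i a - nSA x i a * M.P a i j)
  set Db : Finset (Fin (T + 1) → Fin N × Fin A) := Finset.univ.filter fun x =>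
    T * (c / 2 * (θ / 4)) ≤ 1 * (m x j i b - nSA x i b * M.P b i j)
  have hu : 0 ≤ c / 2 * (θ / 4) := by positivity
  have h1 : ∑ x ∈ Ea, trajProb M π x ≤ Real.exp (-(κ * T)) :=
    (hEa Ea fun x hx => by
      rw [← nSA_eq_card]; exact (Finset.mem_filter.1 hx).2).trans (hmono T _ hκ1)
  have h2 : ∑ x ∈ Eb, trajProb M π x ≤ Real.exp (-(κ * T)) :=
    (hEb Eb fun x hx => by
      rw [← nSA_eq_card]; exact (Finset.mem_filter.1 hx).2).trans (hmono T _ hκ1)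
  have h3 : ∑ x ∈ Da, trajProb M π x ≤ Real.exp (-(κ * T)) :=
    (sum_trajProb_deviation_le M π i j a (by simp) hu Da
      fun x hx => (Finset.mem_filter.1 hx).2).trans (hmono T _ hκ2)
  have h4 : ∑ x ∈ Db, trajProb M π x ≤ Real.exp (-(κ * T)) :=
    (sum_trajProb_deviation_le M π i j b (by simp) hu Db
      fun x hx => (Finset.mem_filter.1 hx).2).trans (hmono T _ hκ2)
  have hnn : ∀ E : Finset (Fin (T + 1) → Fin N × Fin A), 0 ≤ ∑ x ∈ E, trajProb M π x :=
    fun E => Finset.sum_nonneg fun x _ => trajProb_nonneg M π x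
  have hunion : ∀ E F : Finset (Fin (T + 1) → Fin N × Fin A), ∑ x ∈ E ∪ F, trajProb M π x ≤
      ∑ x ∈ E, trajProb M π x + ∑ x ∈ F, trajProb M π x := fun E F => by
    rw [← Finset.sum_union_inter]
    linarith [hnn (E ∩ F)]
  have hsub : typeTwoError M π α T ≤ ∑ x ∈ (Ea ∪ Eb) ∪ (Da ∪ Db), trajProb M π x := by
    refine Finset.sum_le_sum_of_subset_of_nonneg (fun x hx => ?_)
      fun x _ _ => trajProb_nonneg M π x
    -- Only acceptance at the final time n = T is used.
    have hL : lrStat x ≤ t := (Finset.mem_filter.1 hx).2 T le_rfl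
    simp only [Ea, Eb, Da, Db, Finset.mem_union, Finset.mem_filter, Finset.mem_univ, true_and]
    by_contra hcon
    push Not at hcon
    obtain ⟨⟨ha, hb⟩, hda, hdb⟩ := hcon
    rcases deviation_of_lrStat_le x hN (j := j) (d := c / 2 * T) hθ hPθ (by positivity) (by linarith) hL
      ha.le hb.le with hd | hd <;> linarith
  linarith [hunion (Ea ∪ Eb) (Da ∪ Db), hunion Ea Eb, hunion Da Db]

/-! ### The Poisson equation of the state-action chain -/

/-- Averaging over actions turns a solution of the Poisson equation of the state-action chain into
one for the state chain. -/
lemma poisson_average {h : Fin N × Fin A → ℝ} {c : ℝ} {i : Fin N} {a : Fin A}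
    (hh : ∀ s, h s = (if s = (i, a) then 1 else 0) - c + ((jointMatrix M π).mulVec h) s)
    (s : Fin N) : ∑ b, π.prob s b * h (s, b) = (if s = i then π.prob i a else 0) - c +
      (inducedMatrix M π).mulVec (fun s => ∑ b, π.prob s b * h (s, b)) s := by
  set f : Fin N → ℝ := fun s => ∑ b, π.prob s b * h (s, b) with hf
  have hZ : ∀ b, ((jointMatrix M π).mulVec h) (s, b) = ∑ k, M.P b s k * f k := by
    intro b
    simp only [hf, Matrix.mulVec, dotProduct, jointMatrix, Fintype.sum_prod_type, Finset.mul_sum,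
      mul_assoc]
  have h1 : ∑ b, π.prob s b * (if ((s, b) : Fin N × Fin A) = (i, a) then 1 else 0) =
      if s = i then π.prob i a else 0 := by
    by_cases hs : s = i
    · subst hs; simp
    · simp [hs]
  have h2 : ∑ b, π.prob s b * ((jointMatrix M π).mulVec h) (s, b) =
      (inducedMatrix M π).mulVec f s := by
    rw [Finset.sum_congr rfl fun b _ => by rw [hZ b, Finset.mul_sum], Finset.sum_comm]
    refine Finset.sum_congr rfl fun k _ => ?_
    simp only [inducedMatrix, Finset.sum_mul]
    exact Finset.sum_congr rfl fun b _ => (mul_assoc _ _ _).symm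
  rw [← h1, ← h2]
  calc ∑ b, π.prob s b * h (s, b) = ∑ b, π.prob s b *
        ((if ((s, b) : Fin N × Fin A) = (i, a) then 1 else 0) - c +
          ((jointMatrix M π).mulVec h) (s, b)) :=
        Finset.sum_congr rfl fun b _ => by rw [← hh]
    _ = _ := by
        simp only [mul_add, mul_sub, Finset.sum_add_distrib, Finset.sum_sub_distrib,
          ← Finset.sum_mul, (π.prob_mem s).2, one_mul]

/-- The constant in the Poisson equation is the stationary probability. -/
lemma poisson_const_eq {h : Fin N × Fin A → ℝ} {c : ℝ} {i : Fin N} {a : Fin A}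
    (hh : ∀ s, h s = (if s = (i, a) then 1 else 0) - c + ((jointMatrix M π).mulVec h) s)
    {w : Fin N → ℝ} (hw : IsPerronVector (inducedMatrix M π) w) : c = w i * π.prob i a := by
  set f : Fin N → ℝ := fun s => ∑ b, π.prob s b * h (s, b) with hf
  have h1 : ∀ s, f s = (if s = i then π.prob i a else 0) - c + (inducedMatrix M π).mulVec f s :=
    poisson_average M π hh
  have h2 : w ⬝ᵥ (inducedMatrix M π).mulVec f = w ⬝ᵥ f := by
    rw [Matrix.dotProduct_mulVec, hw.2]
  have h3 : w ⬝ᵥ f = w i * π.prob i a - c + w ⬝ᵥ (inducedMatrix M π).mulVec f := by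
    calc w ⬝ᵥ f = ∑ s, w s * ((if s = i then π.prob i a else 0) - c +
          (inducedMatrix M π).mulVec f s) := Finset.sum_congr rfl fun s _ => by rw [← h1]
      _ = _ := by
        simp only [mul_add, mul_sub, Finset.sum_add_distrib, Finset.sum_sub_distrib,
          ← Finset.sum_mul, hw.1.2, one_mul]
        simp [dotProduct]
  linarith

/-- Since p − q has total mass 0, f may be centred at its midrange, where |f| ≤ D/2. This is
Dobrushin's contraction estimate. -/
lemma sum_mul_sub_sum_mul_le {ι : Type*} [Fintype ι] {p q f : ι → ℝ} {D : ℝ}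
    (hpq : ∑ k, p k = ∑ k, q k) (hf : ∀ k l, f k - f l ≤ D) :
    ∑ k, p k * f k - ∑ k, q k * f k ≤ 1 / 2 * (∑ k, |p k - q k|) * D := by
  cases isEmpty_or_nonempty ι with
  | inl _ => simp
  | inr _ =>
    obtain ⟨k₀, hk₀⟩ := Finite.exists_max f
    obtain ⟨l₀, hl₀⟩ := Finite.exists_min f
    set μ := (f k₀ + f l₀) / 2 with hμ
    have habs : ∀ k, |f k - μ| ≤ D / 2 := fun k => by
      rw [abs_le]
      constructor <;> linarith [hk₀ k, hl₀ k, hf k₀ l₀]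
    calc ∑ k, p k * f k - ∑ k, q k * f k = ∑ k, (p k - q k) * (f k - μ) := by
          simp only [sub_mul, mul_sub, Finset.sum_sub_distrib, ← Finset.sum_mul, hpq]
          ring
      _ ≤ ∑ k, |p k - q k| * (D / 2) := Finset.sum_le_sum fun k _ =>
          (le_abs_self _).trans (by
            rw [abs_mul]; exact mul_le_mul_of_nonneg_left (habs k) (abs_nonneg _))
      _ = _ := by rw [← Finset.sum_mul]; ring

lemma half_sum_abs_sub_le_tau1 (Q : Matrix (Fin N) (Fin N) ℝ) (i j : Fin N) :
    1 / 2 * ∑ k, |Q i k - Q j k| ≤ tau1 Q :=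
  mul_le_mul_of_nonneg_left
    ((le_ciSup (f := fun j => ∑ k, |Q i k - Q j k|) (Set.finite_range _).bddAbove j).trans
      (le_ciSup (f := fun i => ⨆ j, ∑ k, |Q i k - Q j k|) (Set.finite_range _).bddAbove i))
    (by norm_num)

lemma tau1_nonneg (Q : Matrix (Fin N) (Fin N) ℝ) : 0 ≤ tau1 Q :=
  mul_nonneg (by norm_num) (Real.iSup_nonneg fun _ => Real.iSup_nonneg fun _ =>
    Finset.sum_nonneg fun _ _ => abs_nonneg _)

lemma tau1_le_one {Q : Matrix (Fin N) (Fin N) ℝ} (hQ : Q ∈ Matrix.rowStochastic ℝ (Fin N)) :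
    tau1 Q ≤ 1 := by
  have h : (⨆ i, ⨆ j, ∑ k, |Q i k - Q j k|) ≤ 2 := by
    refine Real.iSup_le (fun i => Real.iSup_le (fun j => ?_) zero_le_two) zero_le_two
    calc ∑ k, |Q i k - Q j k| ≤ ∑ k, (Q i k + Q j k) := Finset.sum_le_sum fun k _ => by
          rw [abs_le]; constructor <;> linarith [hQ.1 i k, hQ.1 j k]
      _ = 2 := by
          rw [Finset.sum_add_distrib, Matrix.sum_row_of_mem_rowStochastic hQ,
            Matrix.sum_row_of_mem_rowStochastic hQ]
          norm_num
  rw [tau1]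
  linarith

/-- The oscillation of a solution of the Poisson equation is controlled by the coefficient of
ergodicity. -/
lemma poisson_osc_le {h : Fin N × Fin A → ℝ} {c : ℝ} {i : Fin N} {a : Fin A}
    (hh : ∀ s, h s = (if s = (i, a) then 1 else 0) - c + ((jointMatrix M π).mulVec h) s)
    (hτ : tau1 (inducedMatrix M π) < 1) (x y : Fin N × Fin A) :
    h x - h y ≤ 2 / (1 - tau1 (inducedMatrix M π)) := by
  have : Nonempty (Fin N) := ⟨i⟩
  set τ := tau1 (inducedMatrix M π) with hτdef
  set f : Fin N → ℝ := fun s => ∑ b, π.prob s b * h (s, b) with hf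
  have hτ0 : 0 ≤ τ := tau1_nonneg _
  have h1 : ∀ s, f s = (if s = i then π.prob i a else 0) - c + (inducedMatrix M π).mulVec f s :=
    poisson_average M π hh
  have hQ := inducedMatrix_mem M π
  have hπ0 : 0 ≤ π.prob i a := (π.prob_mem i).1 a
  have hπ1 : π.prob i a ≤ 1 := by
    rw [← (π.prob_mem i).2]
    exact Finset.single_le_sum (fun b _ => (π.prob_mem i).1 b) (Finset.mem_univ a)
  obtain ⟨s₁, hs₁⟩ := Finite.exists_max f
  obtain ⟨s₂, hs₂⟩ := Finite.exists_min f
  set D := f s₁ - f s₂ with hD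
  have hosc : ∀ k l, f k - f l ≤ D := fun k l => by linarith [hs₁ k, hs₂ l]
  have hD0 : 0 ≤ D := by linarith [hs₁ s₂]
  -- Compare the averaged equation at a maximum and a minimum of f: the source terms differ by at
  -- most 1, and averaging contracts the oscillation by τ.
  have hDle : D ≤ 1 + τ * D := by
    have h2 := sum_mul_sub_sum_mul_le (p := inducedMatrix M π s₁) (q := inducedMatrix M π s₂)
      (by rw [Matrix.sum_row_of_mem_rowStochastic hQ, Matrix.sum_row_of_mem_rowStochastic hQ]) hosc
    have h3 : (if s₁ = i then π.prob i a else 0) - (if s₂ = i then π.prob i a else 0) ≤ 1 := by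
      split_ifs <;> linarith
    have h4 := mul_le_mul_of_nonneg_right
      (half_sum_abs_sub_le_tau1 (inducedMatrix M π) s₁ s₂) hD0
    have h5 := h1 s₁
    have h6 := h1 s₂
    simp only [Matrix.mulVec, dotProduct] at h5 h6
    linarith
  have hZ : ∀ x, ((jointMatrix M π).mulVec h) x = ∑ k, M.P x.2 x.1 k * f k := by
    intro x
    simp only [hf, Matrix.mulVec, dotProduct, jointMatrix, Fintype.sum_prod_type, Finset.mul_sum,
      mul_assoc]
  have hrow := fun x : Fin N × Fin A =>
    Matrix.sum_row_of_mem_rowStochastic (M.P_mem x.2) x.1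
  have hx : ∑ k, M.P x.2 x.1 k * f k ≤ f s₁ := by
    calc _ ≤ ∑ k, M.P x.2 x.1 k * f s₁ := Finset.sum_le_sum fun k _ =>
          mul_le_mul_of_nonneg_left (hs₁ k) ((M.P_mem _).1 _ _)
      _ = _ := by rw [← Finset.sum_mul, hrow, one_mul]
  have hy : f s₂ ≤ ∑ k, M.P y.2 y.1 k * f k := by
    calc _ = ∑ k, M.P y.2 y.1 k * f s₂ := by rw [← Finset.sum_mul, hrow, one_mul]
      _ ≤ _ := Finset.sum_le_sum fun k _ =>
          mul_le_mul_of_nonneg_left (hs₂ k) ((M.P_mem _).1 _ _)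
  have hxy : h x - h y ≤ 1 + D := by
    have h2 : ((if x = (i, a) then 1 else 0) : ℝ) - (if y = (i, a) then 1 else 0) ≤ 1 := by
      split_ifs <;> norm_num
    rw [hh x, hh y, hZ, hZ]
    linarith
  -- From D(1 − τ) ≤ 1 it follows that (1 + D)(1 − τ) ≤ 2 − τ ≤ 2.
  rw [le_div_iff₀ (by linarith)]
  have h7 : (h x - h y) * (1 - τ) ≤ (1 + D) * (1 - τ) :=
    mul_le_mul_of_nonneg_right hxy (by linarith)
  linarith

/-! ### Constants of the model -/

lemma exists_theta_eq (hθ : 0 < theta M) :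
    ∃ i j a b, M.P a i j - M.P b i j = theta M := by
  rcases isEmpty_or_nonempty (Fin N) with _ | _
  -- Real suprema and infima over an empty index are 0, so θ > 0 excludes N = 0 and A = 0.
  · simp [theta, Real.iSup_of_isEmpty] at hθ
  rcases isEmpty_or_nonempty (Fin A) with _ | _
  · simp [theta, Real.iSup_of_isEmpty, Real.iInf_of_isEmpty] at hθ
  obtain ⟨i, hi⟩ := exists_eq_ciSup_of_finite
    (f := fun i => ⨆ j, ((⨆ a, M.P a i j) - ⨅ a, M.P a i j))
  obtain ⟨j, hj⟩ := exists_eq_ciSup_of_finite (f := fun j => ((⨆ a, M.P a i j) - ⨅ a, M.P a i j))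
  obtain ⟨a, ha⟩ := exists_eq_ciSup_of_finite (f := fun a => M.P a i j)
  obtain ⟨b, hb⟩ := exists_eq_ciInf_of_finite (f := fun a => M.P a i j)
  exact ⟨i, j, a, b, by rw [theta, ← hi, ← hj, ← ha, ← hb]⟩

lemma pMin_nonneg : 0 ≤ pMin M :=
  Real.sInf_nonneg (by rintro _ ⟨-, a, i, j, rfl⟩; exact (M.P_mem a).1 i j)

lemma pMin_le_one : pMin M ≤ 1 := by
  rcases Set.eq_empty_or_nonempty {p : ℝ | p ≠ 0 ∧ ∃ a i j, M.P a i j = p} with h | ⟨p, hp⟩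
  · simp [pMin, h]
  · refine (csInf_le ⟨0, ?_⟩ hp).trans ?_
    · rintro _ ⟨-, a, i, j, rfl⟩
      exact (M.P_mem a).1 i j
    · obtain ⟨-, a, i, j, rfl⟩ := hp
      exact Matrix.le_one_of_mem_rowStochastic (M.P_mem a)

lemma div_le_explore {ε : ℝ} (hε : ε ∈ Set.Icc (0 : ℝ) 1) (i : Fin N) (a : Fin A) :
    ε / A ≤ (π.explore ε hε).prob i a :=
  le_add_of_nonneg_right (mul_nonneg (sub_nonneg.2 hε.2) ((π.prob_mem i).1 a))

lemma le_decayRate {β : ℕ → ℝ} (hβ : ∀ T, 0 ≤ β T) {C κ : ℝ}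
    (h : ∀ᶠ T : ℕ in atTop, β T ≤ C * Real.exp (-(κ * T))) : (κ : EReal) ≤ decayRate β := by
  -- It suffices that every real z < κ is admissible in the supremum; κ itself need not be.
  refine EReal.ge_of_forall_gt_iff_ge.1 fun z hz => le_sSup ⟨z, ?_, rfl⟩
  have hz' : 0 < κ - z := sub_pos.2 (EReal.coe_lt_coe_iff.1 hz)
  have hlim : Tendsto (fun T : ℕ => C * Real.exp (-((κ - z) * T))) atTop (𝓝 0) := by
    rw [← mul_zero C]
    exact ((Real.tendsto_exp_neg_atTop_nhds_zero.comp
      (tendsto_natCast_atTop_atTop.const_mul_atTop hz'))).const_mul C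
  refine squeeze_zero' (Eventually.of_forall fun T => mul_nonneg (Real.exp_pos _).le (hβ T)) ?_ hlim
  filter_upwards [h] with T hT
  calc Real.exp (z * T) * β T ≤ Real.exp (z * T) * (C * Real.exp (-(κ * T))) :=
        mul_le_mul_of_nonneg_left hT (Real.exp_pos _).le
    _ = C * (Real.exp (z * T) * Real.exp (-(κ * T))) := by ring
    _ = _ := by rw [← Real.exp_add]; ring_nf

lemma exists_typeTwoError_le (α : ℝ) (hirr : (jointMatrix M π).IsIrreducible)
    (hθ : 0 < theta M) : ∃ κ > 0, ∃ C : ℝ, ∀ T : ℕ,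
      typeTwoError M π α T ≤ C * Real.exp (-(κ * T)) := by
  obtain ⟨i, j, a, b, hPθ⟩ := exists_theta_eq M hθ
  have hZ := jointMatrix_mem M π
  obtain ⟨h, c, hc, hh⟩ := exists_poisson hZ hirr (i, a)
  obtain ⟨g, d, hd, hg⟩ := exists_poisson hZ hirr (i, b)
  have hosc : ∀ f : Fin N × Fin A → ℝ, ∃ B > 0, ∀ s s', f s - f s' ≤ B := by
    intro f
    obtain ⟨B, hB⟩ := (Set.finite_range fun p : (Fin N × Fin A) × (Fin N × Fin A) =>
      f p.1 - f p.2).bddAbove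
    exact ⟨max B 1, by positivity, fun s s' => (hB ⟨(s, s'), rfl⟩).trans (le_max_left _ _)⟩
  obtain ⟨B₁, hB₁, hhB⟩ := hosc h
  obtain ⟨B₂, -, hgB⟩ := hosc g
  have hcd : 0 < min c d := lt_min hc hd
  have hB : 0 < max B₁ B₂ := lt_max_of_lt_left hB₁
  set κ := min ((min c d / 4) ^ 2 / (2 * max B₁ B₂ ^ 2)) ((min c d / 2 * (theta M / 4)) ^ 2 / 2)
  have hκ : 0 < κ := lt_min (by positivity) (by positivity)
  have hev := eventually_typeTwoError_le M π α (κ := κ) hcd hB hθ hPθ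
    (fun s => (hh s).le.trans (by linarith [min_le_left c d]))
    (fun s => (hg s).le.trans (by linarith [min_le_right c d]))
    (fun s s' => (hhB s s').trans (le_max_left _ _))
    (fun s s' => (hgB s s').trans (le_max_right _ _)) (min_le_left _ _) (min_le_right _ _)
  obtain ⟨T₀, hT₀⟩ := eventually_atTop.1 hev
  -- The second entry of the maximum covers T ≤ T₀ through the trivial bound β ≤ 1.
  refine ⟨κ, hκ, max 4 (Real.exp (κ * T₀)), fun T => ?_⟩
  rcases le_total T₀ T with hT | hT
  · exact (hT₀ T hT).trans (mul_le_mul_of_nonneg_right (le_max_left _ _) (Real.exp_pos _).le)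
  · refine (typeTwoError_le_one M π α T).trans ?_
    calc (1 : ℝ) ≤ Real.exp (κ * T₀) * Real.exp (-(κ * T)) := by
          rw [← Real.exp_add]
          refine Real.one_le_exp ?_
          have := mul_le_mul_of_nonneg_left (Nat.cast_le (α := ℝ).2 hT) hκ.le
          linarith
      _ ≤ _ := mul_le_mul_of_nonneg_right (le_max_right _ _) (Real.exp_pos _).le

/-- The numerical comparison of the claimed rate with the two rates of the proof. -/
lemma rate_le {N A ε θ p w τ : ℝ} (hN : 1 ≤ N) (hA : 1 ≤ A) (hθ0 : 0 ≤ θ) (hθ1 : θ ≤ 1)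
    (hp0 : 0 ≤ p) (hp1 : p ≤ 1) (hτ : τ < 1) :
    (2 * A * N * (24 * A) ^ 2)⁻¹ * min 1 (A * N * (1 - τ) ^ 2 / 4) * ε ^ 2 * θ ^ 2 * p ^ 2 * w ^ 2 ≤
        (w * (ε / A) / 4) ^ 2 / (2 * (2 / (1 - τ)) ^ 2) ∧
    (2 * A * N * (24 * A) ^ 2)⁻¹ * min 1 (A * N * (1 - τ) ^ 2 / 4) * ε ^ 2 * θ ^ 2 * p ^ 2 * w ^ 2 ≤
        (w * (ε / A) / 2 * (θ / 4)) ^ 2 / 2 := by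
  have hτ' : 0 < 1 - τ := sub_pos.2 hτ
  have hN0 : 0 < N := by linarith
  have hA0 : 0 < A := by linarith
  have hp2 : p ^ 2 ≤ 1 := pow_le_one₀ hp0 hp1
  have hθp : θ ^ 2 * p ^ 2 ≤ 1 := mul_le_one₀ (pow_le_one₀ hθ0 hθ1) (sq_nonneg _) hp2
  -- The right-hand sides are (1 − τ)²ε²w²/(128A²) and θ²ε²w²/(128A²). The second argument of the
  -- minimum serves the first bound, and the argument 1 serves the second. The surplus factors p²,
  -- and θ² in the first bound, are at most 1.
  constructor
  · calc _ ≤ (2 * A * N * (24 * A) ^ 2)⁻¹ * (A * N * (1 - τ) ^ 2 / 4) * ε ^ 2 * θ ^ 2 * p ^ 2 *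
            w ^ 2 := by
          gcongr
          exact min_le_right _ _
      _ = ((1 - τ) ^ 2 * ε ^ 2 * w ^ 2 / (4608 * A ^ 2)) * (θ ^ 2 * p ^ 2) := by
          field_simp; ring
      _ ≤ ((1 - τ) ^ 2 * ε ^ 2 * w ^ 2 / (4608 * A ^ 2)) * 1 :=
          mul_le_mul_of_nonneg_left hθp (by positivity)
      _ ≤ (1 - τ) ^ 2 * ε ^ 2 * w ^ 2 / (128 * A ^ 2) := by
          rw [mul_one]
          gcongr
          norm_num
      _ = _ := by field_simp; ring
  · have hAN : 1 ≤ A * N := one_le_mul_of_one_le_of_one_le hA hN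
    calc _ ≤ (2 * A * N * (24 * A) ^ 2)⁻¹ * 1 * ε ^ 2 * θ ^ 2 * p ^ 2 * w ^ 2 := by
          gcongr
          exact min_le_left _ _
      _ = (ε ^ 2 * θ ^ 2 * w ^ 2 / (1152 * A ^ 2 * (A * N))) * p ^ 2 := by
          field_simp; ring
      _ ≤ (ε ^ 2 * θ ^ 2 * w ^ 2 / (1152 * A ^ 2 * (A * N))) * 1 :=
          mul_le_mul_of_nonneg_left hp2 (by positivity)
      _ ≤ ε ^ 2 * θ ^ 2 * w ^ 2 / (128 * A ^ 2) := by
          rw [mul_one]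
          refine div_le_div_of_nonneg_left (by positivity) (by positivity) ?_
          nlinarith [sq_nonneg A, mul_le_mul_of_nonneg_left hAN (sq_nonneg A)]
      _ = _ := by field_simp; ring

end MDP

end LRTest

/-! ### Exponential decay and the explicit rate -/

open LRTest in
theorem theorem2 {N A : ℕ} (M : LRTest.MDP N A) (πE : LRTest.Policy N A)
    (ε : ℝ) (hε0 : 0 < ε) (hε1 : ε ≤ 1) (α : ℝ) (hα0 : 0 < α) (hα1 : α ≤ 1)
    (hirr : (LRTest.jointMatrix M (πE.explore ε ⟨hε0.le, hε1⟩)).IsIrreducible)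
    (hθ : 0 < LRTest.theta M) :
    (∃ κ > 0, ∃ C : ℝ, ∀ T : ℕ,
      LRTest.typeTwoError M (πE.explore ε ⟨hε0.le, hε1⟩) α T ≤ C * Real.exp (-(κ * T))) ∧
    ∀ w : Fin N → ℝ,
      LRTest.IsPerronVector (LRTest.inducedMatrix M (πE.explore ε ⟨hε0.le, hε1⟩)) w →
      (((2 * A * N * (24 * A) ^ 2 : ℝ)⁻¹ *
          min 1 (A * N *
            (1 - LRTest.tau1 (LRTest.inducedMatrix M (πE.explore ε ⟨hε0.le, hε1⟩))) ^ 2 / 4) *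
          ε ^ 2 * LRTest.theta M ^ 2 * LRTest.pMin M ^ 2 * (⨅ s, w s) ^ 2 : ℝ) : EReal) ≤
        LRTest.decayRate (LRTest.typeTwoError M (πE.explore ε ⟨hε0.le, hε1⟩) α) := by
  set π := πE.explore ε ⟨hε0.le, hε1⟩ with hπ
  obtain ⟨κ, hκ, C, hC⟩ := exists_typeTwoError_le M π α hirr hθ
  refine ⟨⟨κ, hκ, C, hC⟩, fun w hw => ?_⟩
  have hβ := typeTwoError_nonneg M π α
  obtain ⟨i, j, a, b, hPθ⟩ := exists_theta_eq M hθ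
  have hN : 1 ≤ (N : ℝ) := Nat.one_le_cast.2 i.pos
  have hA : 1 ≤ (A : ℝ) := Nat.one_le_cast.2 a.pos
  set τ := tau1 (inducedMatrix M π) with hτ
  set W := ⨅ s, w s with hW
  rcases le_or_gt ((2 * A * N * (24 * A) ^ 2 : ℝ)⁻¹ * min 1 (A * N * (1 - τ) ^ 2 / 4) *
    ε ^ 2 * theta M ^ 2 * pMin M ^ 2 * W ^ 2) 0 with hK | hK
  -- In the degenerate case, such as τ = 1 or W = 0, the claimed bound is nonpositive and any
  -- positive rate suffices.
  · exact (EReal.coe_le_coe_iff.2 (hK.trans hκ.le)).trans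
      (le_decayRate hβ (Eventually.of_forall hC))
  have hτ1 : τ < 1 := (tau1_le_one (inducedMatrix_mem M π)).lt_of_ne fun h => by
    simp [hτ, h] at hK
  have hW0 : 0 < W := (Real.iInf_nonneg hw.1.1).lt_of_ne' fun h => by
    simp [hW, h] at hK
  have hθ1 : theta M ≤ 1 := by
    have h1 := Matrix.le_one_of_mem_rowStochastic (M.P_mem a) (i := i) (j := j)
    have h2 := (M.P_mem b).1 i j
    linarith
  have hc : 0 < W * (ε / A) := by positivity
  have hB : 0 < 2 / (1 - τ) := div_pos two_pos (sub_pos.2 hτ1)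
  have hZ := jointMatrix_mem M π
  -- Exploration gives every action probability at least ε/A, so W ε/A is a common lower bound for
  -- the stationary probabilities of (i,a) and (i,b).
  have hcle : ∀ {a : Fin A} {h c}, (∀ s, h s = (if s = (i, a) then 1 else 0) - c +
      ((jointMatrix M π).mulVec h) s) → W * (ε / A) ≤ c := by
    intro a h c hh
    rw [poisson_const_eq M π hh hw]
    exact mul_le_mul (ciInf_le (Set.finite_range w).bddBelow i)
      (div_le_explore πE ⟨hε0.le, hε1⟩ i a) (by positivity) (hw.1.1 i)
  obtain ⟨h, c, -, hh⟩ := exists_poisson hZ hirr (i, a)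
  obtain ⟨g, d, -, hg⟩ := exists_poisson hZ hirr (i, b)
  obtain ⟨hκ1, hκ2⟩ := rate_le (ε := ε) (w := W) hN hA hθ.le hθ1 (pMin_nonneg M)
    (pMin_le_one M) hτ1
  exact le_decayRate hβ (eventually_typeTwoError_le M π α hc hB hθ hPθ
    (fun s => (hh s).le.trans (by linarith [hcle hh]))
    (fun s => (hg s).le.trans (by linarith [hcle hg]))
    (poisson_osc_le M π hh hτ1) (poisson_osc_le M π hg hτ1) hκ1 hκ2)
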